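/- Let $\beta,\gamma>0$ satisfy $\beta\gamma^2=1$. For $n,m\in\mathbb N$ and $p\in[0,1]$ let $\mathbb B(n,m,p)$ be the random bipartite graph with vertex set $V=\{v_1,\dots,v_n\}$ on one side and a set $\{a_1,\dots,a_m\}$ of auxiliary vertices on the other, in which each of the $nm$ possible edges $\{a_k,v_i\}$ is present independently with probability $p$. The random intersection graph $\mathbb G(n,m,p)$ is the graph on $V$ in which two distinct vertices $v_i,v_j$ are adjacent if and only if there is at least one $a_k$ such that both $\{a_k,v_i\}$ and $\{a_k,v_j\}$ are edges of $\mathbb B(n,m,p)$. Let $|\mathcal C_{\max}|$ denote the number of vertices of a largest connected component of $\mathbb G(n,m,p)$. Then there is a finite constant $c_1>0$, depending only on $\beta$ and $\gamma$, such that for every $A>1$ the following holds for all sufficiently large $n$ (how large may depend on $A,\beta,\gamma$): with $m=\lfloor\beta n\rfloor$ and $p=\gamma/n$ (so that $p\in[0,1]$ for large $n$), $$\mathbb P\bigl(|\mathcal C_{\max}|>\lceil A n^{2/3}\rceil\bigr)\le \frac{c_1}{A^{3/2}}.$$ -/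

import Mathlib

open MeasureTheory ProbabilityTheory Filter
open scoped unitInterval

namespace RandomIntersection

/-- The law of the random bipartite graph `B(n, m, p)` with vertices `Fin n` on one side and
auxiliary vertices `Fin m` on the other. A bipartite graph is represented by its set of edges,
a set of pairs `(v, a)`; each of the `n * m` possible edges is present with probability `p`,
independently of the others. -/
noncomputable def bipartiteLaw (n m : ℕ) (p : I) : Measure (Set (Fin n × Fin m)) :=
  setBernoulli Set.univ p

/-- The intersection graph of a bipartite graph `B`: two distinct vertices are neighbours if and
only if some auxiliary vertex is joined to both of them in `B`. Under `bipartiteLaw n m p` this is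
the random intersection graph `G(n, m, p)`. -/
def intersectionGraph {n m : ℕ} (B : Set (Fin n × Fin m)) : SimpleGraph (Fin n) where
  Adj u v := u ≠ v ∧ ∃ a : Fin m, (u, a) ∈ B ∧ (v, a) ∈ B
  symm := ⟨fun _ _ h => ⟨h.1.symm, h.2.imp fun _ ha => ha.symm⟩⟩
  loopless := ⟨fun _ h => h.1 rfl⟩

/-- The component (cluster) of the vertex `v`: all vertices joined to `v` by a path. -/
def cluster {n : ℕ} (G : SimpleGraph (Fin n)) (v : Fin n) : Set (Fin n) :=
  {u | G.Reachable v u}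

/-- The number of vertices of a largest component, i.e. the maximum over `v` of the size of the
component of `v`. -/
noncomputable def maxClusterSize {n : ℕ} (G : SimpleGraph (Fin n)) : ℕ :=
  Finset.univ.sup fun v => (cluster G v).ncard

end RandomIntersection

/-! If some component has more than `k` vertices, then at least `k` vertices lie in clusters of size
at least `k`. With `s = 1 - 1/k`, each of these has `2 * (1 - s ^ |cluster|) ≥ 1`, so Markov's
inequality reduces the tail bound to a lower bound `1 - a` for the generating function of a cluster
size (`measureReal_lt_maxClusterSize_le`). Exploring edge by edge, that generating function
dominates every subsolution `(g, h)` of the fixed point equations of a two-type branching process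
with binomial offspring (`potential_le_bernoulliSum`). At criticality the linear terms cancel and
the quadratic one must absorb the loss `1/k`, so `a` of order `k ^ (-1/2)` suffices. The tail is
then of order `n / k ^ (3/2)`, and `k ≥ A * n ^ (2/3)` concludes. -/

namespace RandomIntersection

open Finset

/-! ### Expectations over random subsets as finite sums -/

section BernoulliSum

variable {ι : Type*}

/-- The expectation of `f` evaluated at a random subset of `D` that contains each element
independently with probability `p`. -/
noncomputable def bernoulliSum (p : ℝ) (D : Finset ι) (f : Set ι → ℝ) : ℝ :=
  ∑ B ∈ D.powerset, p ^ #B * (1 - p) ^ (#D - #B) * f B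

lemma bernoulliSum_empty (p : ℝ) (f : Set ι → ℝ) : bernoulliSum p ∅ f = f ∅ := by
  simp [bernoulliSum]

/-- Conditioning on whether `e` is present; this drives the edge-by-edge exploration. -/
lemma bernoulliSum_insert [DecidableEq ι] (p : ℝ) {D : Finset ι} {e : ι} (he : e ∉ D) (f : Set ι → ℝ) :
    bernoulliSum p (insert e D) f =
      (1 - p) * bernoulliSum p D f + p * bernoulliSum p D fun B => f (insert e B) := by
  unfold bernoulliSum
  rw [sum_powerset_insert he, mul_sum, mul_sum]
  congr 1 <;> refine sum_congr rfl fun B hB => ?_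
  · have hc := card_le_card (mem_powerset.1 hB)
    rw [card_insert_of_notMem he, Nat.succ_sub hc, pow_succ]
    ring
  · have heB : e ∉ B := fun h => he (mem_powerset.1 hB h)
    rw [card_insert_of_notMem he, card_insert_of_notMem heB, Nat.add_sub_add_right, pow_succ]
    push_cast
    ring

lemma bernoulliSum_mono {p : ℝ} (hp0 : 0 ≤ p) (hp1 : p ≤ 1) {D : Finset ι} {f g : Set ι → ℝ}
    (h : ∀ B : Set ι, B ⊆ D → f B ≤ g B) : bernoulliSum p D f ≤ bernoulliSum p D g := by
  have hq : 0 ≤ 1 - p := by linarith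
  refine sum_le_sum fun B hB => mul_le_mul_of_nonneg_left (h B ?_) (by positivity)
  exact_mod_cast mem_powerset.1 hB

lemma bernoulliSum_const (p : ℝ) (D : Finset ι) (c : ℝ) :
    bernoulliSum p D (fun _ => c) = c := by
  classical
  induction D using Finset.induction_on with
  | empty => exact bernoulliSum_empty p _
  | insert e D he ih => rw [bernoulliSum_insert p he, ih]; ring

lemma integral_setBernoulli_univ [Fintype ι] (p : I) (f : Set ι → ℝ) :
    ∫ B, f B ∂(setBernoulli (Set.univ : Set ι) p) = bernoulliSum p univ f := by
  classical
  rw [integral_fintype (Integrable.of_finite), bernoulliSum, powerset_univ]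
  refine (Fintype.sum_bijective (fun B : Finset ι => (B : Set ι))
    ⟨coe_injective, fun B => ⟨B.toFinset, Set.coe_toFinset B⟩⟩ _ _ fun B => ?_).symm
  rw [setBernoulli_real_singleton p (Set.subset_univ _) Set.finite_univ,
    Set.ncard_sdiff (Set.subset_univ _), Set.ncard_coe_finset, Set.ncard_univ,
    Nat.card_eq_fintype_card, card_univ, smul_eq_mul]

end BernoulliSum

/-! ### Exploration and comparison with a two-type branching process -/

section Exploration

variable {V W : Type*}

/-- The vertices in `V` that are joined in the bipartite graph `B` to a vertex of `S` or `T`. -/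
def reached (S : Set V) (T : Set W) (B : Set (V × W)) : Set V :=
  {v | ∀ P Q, S ⊆ P → T ⊆ Q → (∀ e ∈ B, e.1 ∈ P ↔ e.2 ∈ Q) → v ∈ P}

/-- The auxiliary vertices in `W` joined in the bipartite graph `B` to a vertex of `S` or `T`. -/
def reachedAux (S : Set V) (T : Set W) (B : Set (V × W)) : Set W :=
  {a | ∀ P Q, S ⊆ P → T ⊆ Q → (∀ e ∈ B, e.1 ∈ P ↔ e.2 ∈ Q) → a ∈ Q}

/-- `reached` and `reachedAux` are the two sides of the intersection of all closed pairs `(P, Q)`,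
which is again closed. -/
lemma mem_reached_iff {S : Set V} {T : Set W} {B : Set (V × W)} {e : V × W} (he : e ∈ B) :
    e.1 ∈ reached S T B ↔ e.2 ∈ reachedAux S T B :=
  forall₄_congr fun _ _ _ _ => forall_congr' fun h => h e he

lemma subset_reached (S : Set V) (T : Set W) (B : Set (V × W)) : S ⊆ reached S T B :=
  fun _ hv _ _ hS _ _ => hS hv

lemma subset_reachedAux (S : Set V) (T : Set W) (B : Set (V × W)) : T ⊆ reachedAux S T B :=
  fun _ ha _ _ _ hT _ => hT ha

/-- An edge between two explored vertices may be removed. -/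
lemma reached_insert_subset {S S' : Set V} {T T' : Set W} {B : Set (V × W)} {e : V × W}
    (hS : S ⊆ S') (hT : T ⊆ T') (h1 : e.1 ∈ S') (h2 : e.2 ∈ T') :
    reached S T (insert e B) ⊆ reached S' T' B := by
  intro v hv
  refine hv _ _ (hS.trans (subset_reached S' T' B)) (hT.trans (subset_reachedAux S' T' B)) ?_
  rintro e' (rfl | he')
  · exact iff_of_true (subset_reached _ _ _ h1) (subset_reachedAux _ _ _ h2)
  · exact mem_reached_iff he'

lemma reached_subset_of_disjoint {S : Set V} {T : Set W} {B : Set (V × W)}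
    (h : ∀ e ∈ B, e.1 ∉ S ∧ e.2 ∉ T) : reached S T B ⊆ S :=
  fun _ hv => hv S T subset_rfl subset_rfl fun e he => iff_of_false (h e he).1 (h e he).2

lemma card_filter_snd_le [DecidableEq W] [Fintype V] (D : Finset (V × W)) (a : W) :
    #{e ∈ D | e.2 = a} ≤ Fintype.card V := by
  refine card_le_card_of_injOn Prod.fst (fun _ _ => mem_coe.2 (mem_univ _)) ?_
  intro e he e' he' h
  simp only [coe_filter, Set.mem_ofPred_eq] at he he'
  exact Prod.ext h (he.2.trans he'.2.symm)

lemma card_filter_fst_le [DecidableEq V] [Fintype W] (D : Finset (V × W)) (v : V) :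
    #{e ∈ D | e.1 = v} ≤ Fintype.card W := by
  refine card_le_card_of_injOn Prod.snd (fun _ _ => mem_coe.2 (mem_univ _)) ?_
  intro e he e' he' h
  simp only [coe_filter, Set.mem_ofPred_eq] at he he'
  exact Prod.ext (he.2.trans he'.2.symm) h

variable [DecidableEq V] [DecidableEq W]

/-- The lower bound for the generating function of the explored set, when the sets `S` and `T`
have been found and the edges in `D` are still to be examined. -/
noncomputable def potential (s x y : ℝ) (S : Finset V) (T : Finset W) (D : Finset (V × W)) : ℝ :=
  s ^ #S * ∏ e ∈ D, ((if e.1 ∈ S then x else 1) * if e.2 ∈ T then y else 1)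

variable {s x y : ℝ} {S : Finset V} {T : Finset W} {D : Finset (V × W)}

lemma potential_nonneg (hs : 0 ≤ s) (hx : 0 ≤ x) (hy : 0 ≤ y) : 0 ≤ potential s x y S T D := by
  refine mul_nonneg (pow_nonneg hs _) (prod_nonneg fun e _ => mul_nonneg ?_ ?_) <;>
    split_ifs <;> first | assumption | exact zero_le_one

lemma potential_insert_edge {e : V × W} (he : e ∉ D) :
    potential s x y S T (insert e D) =
      potential s x y S T D * ((if e.1 ∈ S then x else 1) * if e.2 ∈ T then y else 1) := by
  rw [potential, prod_insert he, potential]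
  ring

lemma potential_insert_aux {a : W} (ha : a ∉ T) :
    potential s x y S (insert a T) D = potential s x y S T D * y ^ #{e ∈ D | e.2 = a} := by
  rw [potential, potential, mul_assoc, ← prod_const y, prod_filter, ← prod_mul_distrib]
  congr 1
  refine prod_congr rfl fun e _ => ?_
  by_cases h : e.2 = a
  · simp [h, ha]
  · simp [h]

lemma potential_insert_vertex {v : V} (hv : v ∉ S) :
    potential s x y (insert v S) T D = potential s x y S T D * (s * x ^ #{e ∈ D | e.1 = v}) := by
  rw [potential, potential, card_insert_of_notMem hv, pow_succ]
  have : ∏ e ∈ D, ((if e.1 ∈ insert v S then x else 1) * if e.2 ∈ T then y else 1) =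
      (∏ e ∈ D, ((if e.1 ∈ S then x else 1) * if e.2 ∈ T then y else 1)) *
        x ^ #{e ∈ D | e.1 = v} := by
    rw [← prod_const, prod_filter, ← prod_mul_distrib]
    refine prod_congr rfl fun e _ => ?_
    by_cases h : e.1 = v
    · simp [h, hv, mul_comm]
    · simp [h]
  rw [this]
  ring

variable [Fintype V] [Fintype W]

/-- Exploring the edges one by one, the generating function of the set of reached vertices is
bounded below by that of a two-type branching process, and hence by any subsolution `(g, h)` of
the fixed point equations of the latter. -/
theorem potential_le_bernoulliSum {p g h : ℝ} (hp0 : 0 ≤ p) (hp1 : p ≤ 1) (hs0 : 0 ≤ s)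
    (hs1 : s ≤ 1) (hg0 : 0 ≤ g) (hg1 : g ≤ 1) (hh0 : 0 ≤ h) (hh1 : h ≤ 1)
    (hg : g ≤ s * (1 - p + p * h) ^ Fintype.card W) (hh : h ≤ (1 - p + p * g) ^ Fintype.card V)
    (S : Finset V) (T : Finset W) (D : Finset (V × W)) :
    potential s (1 - p + p * h) (1 - p + p * g) S T D ≤
      bernoulliSum p D fun B => s ^ (reached (S : Set V) (T : Set W) B).ncard := by
  have hq : 0 ≤ 1 - p := by linarith
  set x := 1 - p + p * h with hx
  set y := 1 - p + p * g with hy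
  have hx0 : 0 ≤ x := by positivity
  have hy0 : 0 ≤ y := by positivity
  have hx1 : x ≤ 1 := by nlinarith
  have hy1 : y ≤ 1 := by nlinarith
  have key (R R' : Set V) (hR : R ⊆ R') : s ^ R'.ncard ≤ s ^ R.ncard :=
    pow_le_pow_of_le_one hs0 hs1 (Set.ncard_le_ncard hR)
  induction hN : #D generalizing S T D with
  | zero =>
    rw [card_eq_zero] at hN
    subst hN
    rw [bernoulliSum_empty, potential, prod_empty, mul_one, ← Set.ncard_coe_finset S]
    exact key _ _ (reached_subset_of_disjoint (by simp))
  | succ N ih =>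
    -- If no unexamined edge meets `S` or `T`, the exploration has ended and `reached` is just `S`.
    by_cases hD : ∃ e ∈ D, e.1 ∈ S ∨ e.2 ∈ T
    · obtain ⟨e, heD, he⟩ := hD
      obtain ⟨D, heD', rfl⟩ : ∃ D', e ∉ D' ∧ insert e D' = D :=
        ⟨D.erase e, notMem_erase e D, insert_erase heD⟩
      rw [card_insert_of_notMem heD', Nat.add_right_cancel_iff] at hN
      rw [bernoulliSum_insert p heD', potential_insert_edge heD']
      have h0 := ih S T D hN
      have hP := potential_nonneg (S := S) (T := T) (D := D) hs0 hx0 hy0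
      -- With probability `1 - p` the edge is absent and the state is kept; otherwise the state
      -- becomes `(S', T')`, at the cost of a factor at least `z`. The average is `1 - p + p * z`.
      have step (S' : Finset V) (T' : Finset W) (z : ℝ) (hS : S ⊆ S') (hT : T ⊆ T')
          (h1 : e.1 ∈ S') (h2 : e.2 ∈ T')
          (hz : potential s x y S T D * z ≤ potential s x y S' T' D) :
          potential s x y S T D * (1 - p + p * z) ≤
            (1 - p) * bernoulliSum p D (fun B => s ^ (reached (S : Set V) (T : Set W) B).ncard) +
            p * bernoulliSum p D
              fun B => s ^ (reached (S : Set V) (T : Set W) (insert e B)).ncard := by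
        have h1 := (hz.trans (ih S' T' D hN)).trans
          (bernoulliSum_mono hp0 hp1 fun B _ => key _ _ (reached_insert_subset (B := B)
            (coe_subset.2 hS) (coe_subset.2 hT) (mem_coe.2 h1) (mem_coe.2 h2)))
        calc _ = (1 - p) * potential s x y S T D + p * (potential s x y S T D * z) := by ring
          _ ≤ _ := by gcongr
      by_cases h1 : e.1 ∈ S
      · by_cases h2 : e.2 ∈ T
        · refine le_trans ?_ (step S T 1 subset_rfl subset_rfl h1 h2 (by rw [mul_one]))
          rw [if_pos h1, if_pos h2]
          refine mul_le_mul_of_nonneg_left ?_ hP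
          nlinarith [mul_le_one₀ hx1 hy0 hy1]
        · rw [if_pos h1, if_neg h2, mul_one]
          -- The new auxiliary vertex costs `y` for each of its at most `card V` unexamined edges,
          -- which `h` covers.
          refine step S (insert e.2 T) h subset_rfl (subset_insert _ _) h1 (mem_insert_self _ _) ?_
          rw [potential_insert_aux h2]
          exact mul_le_mul_of_nonneg_left (hh.trans
            (pow_le_pow_of_le_one hy0 hy1 (card_filter_snd_le D _))) hP
      · have h2 : e.2 ∈ T := he.resolve_left h1
        rw [if_neg h1, if_pos h2, one_mul]
        refine step (insert e.1 S) T g (subset_insert _ _) subset_rfl (mem_insert_self _ _) h2 ?_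
        rw [potential_insert_vertex h1]
        exact mul_le_mul_of_nonneg_left (hg.trans (mul_le_mul_of_nonneg_left
            (pow_le_pow_of_le_one hx0 hx1 (card_filter_fst_le D _)) hs0)) hP
    · push Not at hD
      rw [potential, prod_eq_one fun e he => by simp [hD e he], mul_one]
      rw [← bernoulliSum_const p D (s ^ #S)]
      refine bernoulliSum_mono hp0 hp1 fun B hB => ?_
      rw [← Set.ncard_coe_finset S]
      exact key _ _ (reached_subset_of_disjoint fun e he => hD e (hB he))

end Exploration

/-! ### From cluster generating functions to the largest cluster -/

section Cluster

variable {n m : ℕ}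

lemma cluster_subset_reached (B : Set (Fin n × Fin m)) (v : Fin n) :
    cluster (intersectionGraph B) v ⊆ reached {v} ∅ B := by
  rintro u ⟨w⟩ P Q hP - hPQ
  have hv : v ∈ P := hP rfl
  clear hP
  induction w with
  | nil => exact hv
  | cons hadj _ ih =>
    obtain ⟨-, a, ha, ha'⟩ := hadj
    exact ih ((hPQ _ ha').2 ((hPQ _ ha).1 hv))

/-- A lower bound for the generating function of the size of a cluster. -/
theorem le_integral_pow_ncard_cluster (p : I) {s g h : ℝ} (hs0 : 0 ≤ s) (hs1 : s ≤ 1)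
    (hg0 : 0 ≤ g) (hg1 : g ≤ 1) (hh0 : 0 ≤ h) (hh1 : h ≤ 1)
    (hg : g ≤ s * (1 - p + p * h) ^ m) (hh : h ≤ (1 - p + p * g) ^ n) (v : Fin n) :
    g ≤ ∫ B, s ^ (cluster (intersectionGraph B) v).ncard ∂(bipartiteLaw n m p) := by
  have hp0 : (0 : ℝ) ≤ p := p.2.1
  have hp1 : (p : ℝ) ≤ 1 := p.2.2
  have hq : 0 ≤ 1 - (p : ℝ) := by linarith
  have hx0 : 0 ≤ 1 - (p : ℝ) + p * h := by positivity
  have hx1 : 1 - (p : ℝ) + p * h ≤ 1 := by nlinarith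
  rw [bipartiteLaw, integral_setBernoulli_univ]
  calc g ≤ s * (1 - p + p * h) ^ m := hg
    _ ≤ potential s (1 - p + p * h) (1 - p + p * g) {v} (∅ : Finset (Fin m)) univ := by
      rw [← insert_empty_eq, potential_insert_vertex (notMem_empty v)]
      have hc := card_filter_fst_le (univ : Finset (Fin n × Fin m)) v
      rw [Fintype.card_fin] at hc
      simpa [potential] using
        mul_le_mul_of_nonneg_left (pow_le_pow_of_le_one hx0 hx1 hc) hs0
    _ ≤ bernoulliSum p univ fun B => s ^ (reached (({v} : Finset (Fin n)) : Set (Fin n))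
          ((∅ : Finset (Fin m)) : Set (Fin m)) B).ncard :=
      potential_le_bernoulliSum hp0 hp1 hs0 hs1 hg0 hg1 hh0 hh1 (by simpa using hg)
        (by simpa using hh) _ _ _
    _ ≤ _ := by
      refine bernoulliSum_mono hp0 hp1 fun B _ => pow_le_pow_of_le_one hs0 hs1 ?_
      refine Set.ncard_le_ncard ?_
      simpa using cluster_subset_reached B v

lemma cluster_eq_of_mem {G : SimpleGraph (Fin n)} {u v : Fin n} (h : u ∈ cluster G v) :
    cluster G u = cluster G v :=
  Set.ext fun _ => ⟨fun hw => SimpleGraph.Reachable.trans h hw,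
    fun hw => SimpleGraph.Reachable.trans (SimpleGraph.Reachable.symm h) hw⟩

/-- If some cluster has more than `k` vertices, then so do the clusters of all its vertices. -/
lemma le_sum_of_lt_maxClusterSize {G : SimpleGraph (Fin n)} {k : ℕ} (hk : k < maxClusterSize G)
    {f : ℕ → ℝ} (hf0 : ∀ j, 0 ≤ f j) (hf : ∀ j, k ≤ j → 1 ≤ f j) :
    (k : ℝ) ≤ ∑ v, f (cluster G v).ncard := by
  classical
  obtain ⟨v, -, hv⟩ := Finset.lt_sup_iff.1 hk
  calc (k : ℝ) ≤ (cluster G v).ncard := by exact_mod_cast hv.le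
    _ = ∑ u ∈ (cluster G v).toFinset, (1 : ℝ) := by simp [Set.ncard_eq_toFinset_card']
    _ ≤ ∑ u ∈ (cluster G v).toFinset, f (cluster G u).ncard := by
      refine sum_le_sum fun u hu => hf _ ?_
      rw [cluster_eq_of_mem (Set.mem_toFinset.1 hu)]
      exact hv.le
    _ ≤ _ := sum_le_sum_of_subset_of_nonneg (subset_univ _) fun _ _ _ => hf0 _

/-- A bound for the tail of the size of the largest cluster by the generating functions of the
cluster sizes. -/
theorem measureReal_lt_maxClusterSize_le (p : I) {k : ℕ} (hk : 0 < k) {a : ℝ}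
    (h : ∀ v, 1 - a ≤
      ∫ B, (1 - (k : ℝ)⁻¹) ^ (cluster (intersectionGraph B) v).ncard ∂(bipartiteLaw n m p)) :
    (bipartiteLaw n m p).real {B | k < maxClusterSize (intersectionGraph B)} ≤ 2 * n * a / k := by
  have hk' : (0 : ℝ) < k := by exact_mod_cast hk
  have hk1 : (k : ℝ)⁻¹ ≤ 1 := inv_le_one_of_one_le₀ (by exact_mod_cast hk)
  have hs0 : 0 ≤ 1 - (k : ℝ)⁻¹ := by linarith
  have hs1 : 1 - (k : ℝ)⁻¹ ≤ 1 := by linarith [inv_pos.2 hk']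
  -- The power is at most `exp (-1) < 1/2`, which explains the factor 2 in the Markov bound.
  have hhalf : (1 - (k : ℝ)⁻¹) ^ k ≤ 1 / 2 := by
    have := Real.one_sub_div_pow_le_exp_neg (n := k) (t := 1) (by exact_mod_cast hk)
    rw [one_div] at this
    refine this.trans ?_
    rw [Real.exp_neg, one_div]
    exact inv_anti₀ two_pos (by linarith [Real.exp_one_gt_d9])
  have : IsProbabilityMeasure (bipartiteLaw n m p) := by unfold bipartiteLaw; infer_instance
  have hint (f : Set (Fin n × Fin m) → ℝ) : Integrable f (bipartiteLaw n m p) :=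
    Integrable.of_finite
  have hmarkov := mul_meas_ge_le_integral_of_nonneg (μ := bipartiteLaw n m p)
    (f := fun B => ∑ v, 2 * (1 - (1 - (k : ℝ)⁻¹) ^ (cluster (intersectionGraph B) v).ncard))
    (ae_of_all _ fun B => sum_nonneg fun v _ =>
      mul_nonneg two_pos.le (sub_nonneg.2 (pow_le_one₀ hs0 hs1))) (hint _) k
  rw [le_div_iff₀ hk', mul_comm]
  calc _ ≤ _ := mul_le_mul_of_nonneg_left (measureReal_mono fun B hB => ?_) hk'.le
    _ ≤ _ := hmarkov
    _ ≤ _ := ?_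
  · refine le_sum_of_lt_maxClusterSize
      (f := fun j => 2 * (1 - (1 - (k : ℝ)⁻¹) ^ j)) hB (fun j => ?_) fun j hj => ?_
    · exact mul_nonneg two_pos.le (sub_nonneg.2 (pow_le_one₀ hs0 hs1))
    · linarith [pow_le_pow_of_le_one hs0 hs1 hj]
  · rw [integral_finsetSum _ fun _ _ => hint _]
    calc _ ≤ ∑ v : Fin n, 2 * a := by
          refine sum_le_sum fun v _ => ?_
          rw [integral_const_mul, integral_sub (hint _) (hint _)]
          simp only [integral_const, probReal_univ, one_smul]
          linarith [h v]
      _ = 2 * n * a := by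
        rw [sum_const, card_univ, Fintype.card_fin, nsmul_eq_mul]
        ring

end Cluster

/-! ### The critical case -/

/-- Bernoulli's inequality with exponent `m` would give only `1 - a`. Using the exponent `m / 2 ≥ 1`
and squaring gains the term `a ^ 2 / 4`, needed to offset the factor `s`. -/
lemma one_sub_half_sq_le_pow {m : ℕ} (hm : 2 ≤ m) {a z : ℝ} (ha1 : a ≤ 1)
    (hz : m * z ≤ a) : (1 - a / 2) ^ 2 ≤ (1 - z) ^ m := by
  have hm' : (2 : ℝ) ≤ m := by exact_mod_cast hm
  have hm0 : (0 : ℝ) < m := by linarith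
  have ham : a / m ≤ 1 := (div_le_one hm0).2 (by linarith)
  have hz' : z ≤ a / m := by rwa [le_div_iff₀ hm0, mul_comm]
  have hb := one_add_mul_self_le_rpow_one_add (s := -(a / m)) (by linarith) (p := m / 2)
    (by linarith)
  have he : 1 + (m : ℝ) / 2 * -(a / m) = 1 - a / 2 := by field_simp; ring
  rw [he] at hb
  calc (1 - a / 2) ^ 2 ≤ ((1 + -(a / m)) ^ ((m : ℝ) / 2)) ^ 2 :=
        pow_le_pow_left₀ (by linarith) hb 2
    _ = (1 - a / m) ^ m := by
      rw [← Real.rpow_natCast, ← Real.rpow_mul (by linarith), ← Real.rpow_natCast]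
      congr 1
      push_cast
      ring
    _ ≤ (1 - z) ^ m := pow_le_pow_left₀ (by linarith) (by linarith) m

/-- In the critical case, the largest cluster has more than `k` vertices with probability at most
`4 n / k ^ (3 / 2)`. -/
theorem measureReal_lt_maxClusterSize_le_of_critical {n m k : ℕ} {γ : ℝ} (p : I) (hγ : 0 < γ)
    (hnp : n * (p : ℝ) = γ) (hm : 2 ≤ m) (hmp : m * (p : ℝ) * γ ≤ 1) (hk4 : 4 ≤ k)
    (hkγ : (2 * γ) ^ 2 ≤ k) :
    (bipartiteLaw n m p).real {B | k < maxClusterSize (intersectionGraph B)} ≤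
      4 * n / (k * √k) := by
  have hk0 : (0 : ℝ) < k := by exact_mod_cast (by omega : 0 < k)
  have hr0 : 0 < √(k : ℝ) := Real.sqrt_pos.2 hk0
  have hr2 : 2 ≤ √(k : ℝ) := Real.le_sqrt_of_sq_le (by norm_num; exact_mod_cast hk4)
  have hrγ : 2 * γ ≤ √(k : ℝ) := Real.le_sqrt_of_sq_le hkγ
  have hrr : √(k : ℝ) ^ 2 = k := Real.sq_sqrt hk0.le
  have hp0 : (0 : ℝ) ≤ p := p.2.1
  have hp1 : (p : ℝ) ≤ 1 := p.2.2
  -- Chosen so that `a ^ 2 / 4 = 1 / k`, exactly the loss in `s = 1 - 1/k`.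
  set a : ℝ := 2 / √k with ha
  have ha0 : 0 ≤ a := by positivity
  have ha1 : a ≤ 1 := (div_le_one hr0).2 hr2
  have haγ : γ * a ≤ 1 := by
    rw [ha, mul_div_assoc', div_le_one hr0]
    linarith
  have hak : a ^ 2 = 4 * (k : ℝ)⁻¹ := by
    rw [ha, div_pow, hrr]
    ring
  have hk1 : (k : ℝ)⁻¹ ≤ 1 := inv_le_one_of_one_le₀ (by exact_mod_cast (by omega : 1 ≤ k))
  have hki : 0 < (k : ℝ)⁻¹ := inv_pos.2 hk0
  have := measureReal_lt_maxClusterSize_le (n := n) (m := m) p (k := k) (by omega) (a := a)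
    fun v => le_integral_pow_ncard_cluster p (g := 1 - a) (h := 1 - γ * a) (by linarith)
      (by linarith) (by linarith) (by linarith) (by linarith)
      (by linarith [mul_nonneg hγ.le ha0]) ?_ ?_ v
  · refine this.trans (le_of_eq ?_)
    rw [ha]
    field_simp
    ring
  · have hz := one_sub_half_sq_le_pow hm (z := p * (γ * a)) ha1
      (by nlinarith)
    have hka : (k : ℝ)⁻¹ ≤ a := by nlinarith
    have hsq : (1 - a / 2) ^ 2 = 1 - a + (k : ℝ)⁻¹ := by linear_combination hak / 4
    -- The right side minus the left is `(a - 1/k) / k`.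
    calc 1 - a ≤ (1 - (k : ℝ)⁻¹) * (1 - a / 2) ^ 2 := by rw [hsq]; nlinarith
      _ ≤ (1 - (k : ℝ)⁻¹) * (1 - p * (γ * a)) ^ m :=
        mul_le_mul_of_nonneg_left hz (by linarith)
      _ = _ := by ring
  · have hb := one_add_mul_le_pow (a := -(p * a)) (by nlinarith) n
    calc 1 - γ * a = 1 + n * -(p * a) := by rw [← hnp]; ring
      _ ≤ _ := hb
      _ = _ := by ring

end RandomIntersection

theorem proposition1 (β γ : ℝ) (hβ : 0 < β) (hγ : 0 < γ) (hμ : β * γ ^ 2 = 1) :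
    ∃ c₁ : ℝ, 0 < c₁ ∧ ∀ A : ℝ, 1 < A → ∀ᶠ n : ℕ in atTop,
      ∃ hp : γ / (n : ℝ) ∈ Set.Icc (0 : ℝ) 1,
        (RandomIntersection.bipartiteLaw n ⌊β * (n : ℝ)⌋₊ ⟨γ / (n : ℝ), hp⟩).real
            {B | ⌈A * (n : ℝ) ^ (2 / 3 : ℝ)⌉₊ <
              RandomIntersection.maxClusterSize (RandomIntersection.intersectionGraph B)}
          ≤ c₁ / A ^ (3 / 2 : ℝ) := by
  refine ⟨4, by norm_num, fun A hA => ?_⟩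
  have hA0 : 0 < A := by linarith
  have hroot : Tendsto (fun n : ℕ => (n : ℝ) ^ (2 / 3 : ℝ)) atTop atTop :=
    (tendsto_rpow_atTop (by norm_num)).comp tendsto_natCast_atTop_atTop
  filter_upwards [eventually_gt_atTop 0,
    tendsto_natCast_atTop_atTop.eventually_ge_atTop γ,
    tendsto_natCast_atTop_atTop.eventually_ge_atTop (2 / β),
    hroot.eventually_ge_atTop 4, hroot.eventually_ge_atTop ((2 * γ) ^ 2)]
    with n hn hnγ hnβ hn4 hnγ'
  have hn0 : (0 : ℝ) < n := by exact_mod_cast hn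
  have hp : γ / (n : ℝ) ∈ Set.Icc (0 : ℝ) 1 := ⟨by positivity, (div_le_one hn0).2 hnγ⟩
  refine ⟨hp, ?_⟩
  set k := ⌈A * (n : ℝ) ^ (2 / 3 : ℝ)⌉₊ with hk
  have hAk : A * (n : ℝ) ^ (2 / 3 : ℝ) ≤ k := Nat.le_ceil _
  have hrk : (n : ℝ) ^ (2 / 3 : ℝ) ≤ k :=
    (le_mul_of_one_le_left (by positivity) hA.le).trans hAk
  have hk0 : (0 : ℝ) < k := by linarith
  refine (RandomIntersection.measureReal_lt_maxClusterSize_le_of_critical (γ := γ) _ hγ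
    (mul_div_cancel₀ γ hn0.ne') ?_ ?_ (by exact_mod_cast hn4.trans hrk)
    (hnγ'.trans hrk)).trans ?_
  · refine Nat.le_floor ?_
    rw [div_le_iff₀ hβ] at hnβ
    push_cast
    linarith
  · calc (⌊β * (n : ℝ)⌋₊ : ℝ) * (γ / n) * γ ≤ β * n * (γ / n) * γ := by
          gcongr
          exact Nat.floor_le (by positivity)
      _ = β * γ ^ 2 := by field_simp
      _ ≤ 1 := hμ.le
  · have hpow : A ^ (3 / 2 : ℝ) * n ≤ k * √k := by
      calc A ^ (3 / 2 : ℝ) * n = (A * (n : ℝ) ^ (2 / 3 : ℝ)) ^ (3 / 2 : ℝ) := by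
            rw [Real.mul_rpow hA0.le (by positivity), ← Real.rpow_mul hn0.le]
            norm_num
        _ ≤ (k : ℝ) ^ (3 / 2 : ℝ) := by gcongr
        _ = k * √k := by
          rw [Real.sqrt_eq_rpow, ← Real.rpow_one_add' hk0.le (by norm_num)]
          norm_num
    rw [div_le_div_iff₀ (by positivity) (by positivity)]
    linarith
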